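/- Let $L$ be a first-order functional language (no relation symbols, arbitrary sets of constant and function symbols). An *algebra* is a non-empty $L$-structure. For $X=\{x_1,\dots,x_n\}$ an *equation* is an atomic formula $t=s$ with $t,s$ terms in $X$; for a set $S$ of equations, $V_B(S)\subseteq B^n$ is the set of its solutions in the algebra $B$. The sets $V_B(S)$ are the *algebraic sets* over $B$; an algebraic set is *irreducible* if it is non-empty and is not a finite union of proper algebraic subsets. The *coordinate algebra* of an algebraic set $Y\subseteq B^n$ is the algebra of all terms in $X$ modulo the congruence $t\sim s \iff t(b)=s(b)$ for all $b\in Y$. An algebra $B$ is *$u_\omega$-compact* if for every finite $X$, every set $S$ of equations in $X$ and all equations $t_1=s_1,\dots,t_m=s_m$ in $X$ ($m\ge 1$) with $V_B(S)\subseteq V_B(t_1=s_1)\cup\dots\cup V_B(t_m=s_m)$ there is a finite $S_0\subseteq S$ with $V_B(S)\subseteq V_B(S_0)\subseteq V_B(t_1=s_1)\cup\dots\cup V_B(t_m=s_m)$. $C$ is *discriminated* by $B$ if for every finite $W\subseteq C$ there is a homomorphism $C\to B$ that is injective on $W$. An *atomic type* of a theory $T$ in the variables $x_1,\dots,x_n$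 is a set of equations and negations of equations in these variables that is realized in some model of $T$; it is *complete* if it is maximal under inclusion. The algebra *defined by* a complete atomic type $p$ is $\langle x_1,\dots,x_n\mid p^+\rangle$, where $p^+$ is the set of equations in $p$. A *diagram-formula* in a finite set of variables $X$ and a finite set $F$ of function symbols (constants included) is a conjunction of formulas $\neg(x=y)$ (for distinct $x,y\in X$), $f(x_1,\dots,x_k)=y$ and $\neg(f(x_1,\dots,x_k)=y)$ (for $f\in F$ and $x_1,\dots,x_k,y\in X$) that contains every $\neg(x=y)$ with $x\neq y$ and, for all $f\in F$ and $x_1,\dots,x_k,y\in X$, contains $f(x_1,\dots,x_k)=y$ or its negation. A *direct system of formulas over $B$* consists of a non-empty directed partially ordered set $I$; for each $i\in I$ a diagram-formula $\varphi_i$ in variables $X_i$ and function symbols $F_i$ that is realized in $B$, with $F_i\subseteq F_j$ for $i\le j$; and maps $\gamma_{ij}\colon X_i\to X_j$ for $i\le j$ with $\gamma_{ii}=\mathrm{id}$ and $\gamma_{jk}\gamma_{ij}=\gamma_{ik}$, such that $\gamma_{ij}$ takes the conjuncts of $\varphi_i$ to conjuncts of $\varphi_j$, and such that for all $i\in I$,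 every function symbol $f$ and all $x_1,\dots,x_k\in X_i$ there are $j\ge i$ and $y\in X_j$ for which $f(\gamma_{ij}(x_1),\dots,\gamma_{ij}(x_k))=y$ is a conjunct of $\varphi_j$. Its limit is the direct limit of the sets $X_i$ with the operations prescribed by the conjuncts $f(x_1,\dots,x_k)=y$. A *limit algebra over $B$* is an algebra isomorphic to such a limit. **Theorem.** Let $B$ be a $u_\omega$-compact algebra. Then for every finitely generated algebra $C$ the following conditions are equivalent: 1. $\mathrm{Th}_\forall(B)\subseteq \mathrm{Th}_\forall(C)$, i.e. $C\in\mathbf{Ucl}(B)$ (every universal sentence true in $B$ is true in $C$); 2. $\mathrm{Th}_\exists(B)\supseteq \mathrm{Th}_\exists(C)$ (every existential sentence true in $C$ is true in $B$); 3. $C$ embeds into an ultrapower of $B$; 4. $C$ is discriminated by $B$; 5. $C$ is a limit algebra over $B$; 6. $C$ is isomorphic to an algebra defined by a complete atomic type of the theory $\mathrm{Th}_\forall(B)$; 7. $C$ is isomorphic to the coordinate algebra of an irreducible algebraic set over $B$. Moreover, if $B$ is any algebra such that for every finitely generated algebra $C$ conditions 1–7 are equivalent, then $B$ is $u_\omega$-compact.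 -/

import Mathlib

open FirstOrder FirstOrder.Language

universe u v w w'

namespace UAG

/-! ### Equations, algebraic sets, radicals

A functional language is a language `L` with `L.IsAlgebraic` (no relation symbols);
an algebra is a nonempty `L`-structure. -/

section Equations

variable {L : FirstOrder.Language.{u, v}}

/-- An equation (atomic formula) `t = s` of a functional language with variables in `X`. -/
abbrev Equation (L : FirstOrder.Language.{u, v}) (X : Type*) := L.Term X × L.Term X

/-- The set `V_B(S)` of all solutions in `B` of the system of equations `S`. -/
def solutionSet (B : Type w) [L.Structure B] {n : ℕ} (S : Set (Equation L (Fin n))) :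
    Set (Fin n → B) :=
  {b | ∀ e ∈ S, e.1.realize b = e.2.realize b}

/-- `Y ⊆ B ^ n` is an algebraic set over `B`. -/
def IsAlgebraicSet (L : FirstOrder.Language.{u, v}) {B : Type w} [L.Structure B] {n : ℕ}
    (Y : Set (Fin n → B)) : Prop :=
  ∃ S : Set (Equation L (Fin n)), Y = solutionSet B S

/-- `Y` is an irreducible algebraic set over `B`: a nonempty algebraic set which is not a finite
union of proper algebraic subsets. -/
def IsIrreducibleAlgebraicSet (L : FirstOrder.Language.{u, v}) {B : Type w} [L.Structure B] {n : ℕ}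
    (Y : Set (Fin n → B)) : Prop :=
  IsAlgebraicSet L Y ∧ Y.Nonempty ∧
    ∀ Z : Set (Set (Fin n → B)), Z.Finite → (∀ W ∈ Z, IsAlgebraicSet L W ∧ W ⊂ Y) → ⋃₀ Z ≠ Y

/-- The radical `Rad(Y)`: all equations that hold on `Y`. -/
def radical (L : FirstOrder.Language.{u, v}) {B : Type w} [L.Structure B] {n : ℕ} (Y : Set (Fin n → B)) :
    Set (Equation L (Fin n)) :=
  {e | ∀ b ∈ Y, e.1.realize b = e.2.realize b}

/-- The radical of `V_B(S)` is the greatest system of equations equivalent to `S` over `B`. -/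
theorem isGreatest_radical {B : Type w} [L.Structure B] {n : ℕ} (S : Set (Equation L (Fin n))) :
    IsGreatest {S' | solutionSet B S' = solutionSet B S} (radical L (solutionSet B S)) := by
  refine ⟨?_, ?_⟩
  · ext b
    exact ⟨fun h e he => h e fun c hc => hc e he, fun h e he => he b h⟩
  · rintro S' (h : _ = _) e he b hb
    rw [← h] at hb
    exact hb e he

/-- `B` is `u_ω`-compact. -/
def IsUOmegaCompact (L : FirstOrder.Language.{u, v}) (B : Type w) [L.Structure B] : Prop :=
  ∀ (n : ℕ) (S : Set (Equation L (Fin n))) (m : ℕ) (_ : 1 ≤ m) (e : Fin m → Equation L (Fin n)),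
    solutionSet B S ⊆ ⋃ i, solutionSet B {e i} →
    ∃ S₀ : Set (Equation L (Fin n)), S₀ ⊆ S ∧ S₀.Finite ∧
      solutionSet B S ⊆ solutionSet B S₀ ∧ solutionSet B S₀ ⊆ ⋃ i, solutionSet B {e i}

end Equations

/-! ### Congruences on the absolutely free algebra and its factor-algebras -/

section TermCongruences

/-- A congruence on the absolutely free `L`-algebra with basis `X`. -/
structure TermCongruence (L : FirstOrder.Language.{u, v}) (X : Type*) extends Setoid (L.Term X) where
  func_congr : ∀ {k : ℕ} (f : L.Functions k) (ts ss : Fin k → L.Term X),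
    (∀ i, toSetoid (ts i) (ss i)) → toSetoid (Term.func f ts) (Term.func f ss)

variable {L : FirstOrder.Language.{u, v}} {X : Type*}

/-- The factor-algebra of the absolutely free algebra by a congruence. -/
def TermCongruence.Factor (θ : TermCongruence L X) : Type _ := Quotient θ.toSetoid

/-- The absolutely free algebra modulo a congruence, with operations acting on representatives. -/
@[reducible] def TermCongruence.prestructure [L.IsAlgebraic] (θ : TermCongruence L X) :
    L.Prestructure θ.toSetoid where
  toStructure :=
    { funMap := fun f ts => Term.func f ts
      RelMap := fun r _ => isEmptyElim r }
  fun_equiv := fun {_} {f} ts ss h => θ.func_congr f ts ss h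
  rel_equiv := fun {_} {r} => isEmptyElim r

instance TermCongruence.structureFactor [L.IsAlgebraic] (θ : TermCongruence L X) :
    L.Structure θ.Factor :=
  letI := θ.prestructure
  inferInstanceAs (L.Structure (Quotient θ.toSetoid))

/-- The class of a term in the factor-algebra. -/
def TermCongruence.toFactor (θ : TermCongruence L X) (t : L.Term X) : θ.Factor :=
  Quotient.mk θ.toSetoid t

theorem TermCongruence.funMap_toFactor [L.IsAlgebraic] (θ : TermCongruence L X) {k : ℕ}
    (f : L.Functions k) (ts : Fin k → L.Term X) :
    Structure.funMap f (fun i => θ.toFactor (ts i)) = θ.toFactor (Term.func f ts) :=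
  letI := θ.prestructure
  funMap_quotient_mk' θ.toSetoid f ts

/-- `θ_Rad(Y)`: two terms are congruent iff they take the same values on `Y`. -/
def radicalCongruence (L : FirstOrder.Language.{u, v}) {B : Type w} [L.Structure B] {n : ℕ}
    (Y : Set (Fin n → B)) : TermCongruence L (Fin n) where
  r t s := (t, s) ∈ radical L Y
  iseqv :=
    ⟨fun _ _ _ => rfl, fun h b hb => (h b hb).symm, fun h h' b hb => (h b hb).trans (h' b hb)⟩
  func_congr f ts ss h := fun b hb => by
    change Structure.funMap f _ = Structure.funMap f _
    exact congrArg _ (funext fun i => h i b hb)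

/-- The coordinate algebra `Γ(Y)`. -/
abbrev CoordinateAlgebra (L : FirstOrder.Language.{u, v}) {B : Type w} [L.Structure B] {n : ℕ}
    (Y : Set (Fin n → B)) : Type u :=
  (radicalCongruence L Y).Factor

/-- The least congruence relation on terms that contains all pairs `(t, s)` with `(t = s) ∈ S`. -/
inductive CongruentClosure (S : Set (Equation L X)) : L.Term X → L.Term X → Prop
  | of {t s : L.Term X} : (t, s) ∈ S → CongruentClosure S t s
  | refl (t : L.Term X) : CongruentClosure S t t
  | symm {t s : L.Term X} : CongruentClosure S t s → CongruentClosure S s t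
  | trans {t s r : L.Term X} :
      CongruentClosure S t s → CongruentClosure S s r → CongruentClosure S t r
  | func {k : ℕ} (f : L.Functions k) {ts ss : Fin k → L.Term X} :
      (∀ i, CongruentClosure S (ts i) (ss i)) →
        CongruentClosure S (Term.func f ts) (Term.func f ss)

/-- The congruence `θ_S` generated by a system of equations. -/
def generatedCongruence (S : Set (Equation L X)) : TermCongruence L X where
  r := CongruentClosure S
  iseqv := ⟨.refl, .symm, .trans⟩
  func_congr f _ _ h := .func f h

/-- The algebra `⟨X | S⟩` with generators `X` and defining relations `S`. -/
abbrev PresentedAlgebra (S : Set (Equation L X)) : Type _ := (generatedCongruence S).Factor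

end TermCongruences

/-! ### Universal and existential theories, ultrapowers, discrimination, irreducible coordinate
algebras -/

section Conditions

variable (L : FirstOrder.Language.{u, v})

/-- `Th_∀(B)`: all universal sentences true in `B`. -/
def universalTheory (B : Type w) [L.Structure B] : L.Theory := {φ | φ.IsUniversal ∧ B ⊨ φ}

/-- `Th_∃(B)`: all existential sentences true in `B`. -/
def existentialTheory (B : Type w) [L.Structure B] : L.Theory := {φ | φ.IsExistential ∧ B ⊨ φ}

/-- `C` embeds into an ultrapower of `B`. -/
def EmbedsInUltrapower (C : Type w') (B : Type w) [L.Structure C] [L.Structure B] : Prop :=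
  ∃ (I : Type (max u w')) (U : Ultrafilter I),
    Nonempty (C ↪[L] (U : Filter I).Product fun _ => B)

/-- `C` is discriminated by `B`. -/
def IsDiscriminatedBy (C : Type w') (B : Type w) [L.Structure C] [L.Structure B] : Prop :=
  ∀ W : Set C, W.Finite → ∃ h : C →[L] B, Set.InjOn h W

/-- `C` is the coordinate algebra of an irreducible algebraic set over `B`. -/
def IsIrreducibleCoordinateAlgebra [L.IsAlgebraic] (C : Type w') (B : Type w) [L.Structure C]
    [L.Structure B] : Prop :=
  ∃ (n : ℕ) (Y : Set (Fin n → B)),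
    IsIrreducibleAlgebraicSet L Y ∧ Nonempty (C ≃[L] CoordinateAlgebra L Y)

end Conditions

/-! ### Complete atomic types -/

section Types

variable {L : FirstOrder.Language.{u, v}}

/-- `p` is an atomic type of the theory `T` in the variables `x_1, …, x_n`: a set of atomic formulas
and negations of atomic formulas that is realized in some model of `T`. -/
def IsAtomicType (T : L.Theory) {n : ℕ} (p : Set (L.Formula (Fin n))) : Prop :=
  (∀ φ ∈ p, ∃ t s : L.Term (Fin n), φ = t.equal s ∨ φ = (t.equal s).not) ∧
    ∃ (M : Type (max u v)) (_ : L.Structure M) (_ : Nonempty M),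
      M ⊨ T ∧ ∃ a : Fin n → M, ∀ φ ∈ p, φ.Realize a

/-- A complete atomic type of `T` is an atomic type of `T` that is maximal under inclusion. -/
def IsCompleteAtomicType (T : L.Theory) {n : ℕ} (p : Set (L.Formula (Fin n))) : Prop :=
  Maximal (IsAtomicType T) p

/-- The equations that belong to `p`. -/
def positivePart {n : ℕ} (p : Set (L.Formula (Fin n))) : Set (Equation L (Fin n)) :=
  {e | e.1.equal e.2 ∈ p}

/-- `C` is an algebra defined by a complete atomic type in the theory `T`: it is isomorphic to
`⟨x_1, …, x_n | p⁺⟩`, where `p⁺` is the set of equations in a complete atomic type `p` of `T`. -/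
def IsDefinedByCompleteAtomicType [L.IsAlgebraic] (T : L.Theory) (C : Type w') [L.Structure C] :
    Prop :=
  ∃ (n : ℕ) (p : Set (L.Formula (Fin n))),
    IsCompleteAtomicType T p ∧ Nonempty (C ≃[L] PresentedAlgebra (positivePart p))

end Types

/-! ### Limit algebras -/

section Limits

variable {L : FirstOrder.Language.{u, v}}

/-- The formula `¬ (x = y)`, for variables `x` and `y`. -/
def varNe {X : Type*} (x y : X) : L.Formula X :=
  ((Term.var x : L.Term X).equal (Term.var y)).not

/-- The formula `f(x_1, …, x_k) = y`, for variables `x_1, …, x_k, y`. -/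
def funEq {X : Type*} {k : ℕ} (f : L.Functions k) (x : Fin k → X) (y : X) : L.Formula X :=
  (Term.func f fun i => Term.var (x i)).equal (Term.var y)

/-- `D` is the set of conjuncts of a diagram-formula with variables `X` in the reduct `F` of `L`:
every conjunct is of the form `¬ (x = y)` with `x`, `y` distinct, `f(x_1, …, x_k) = y`, or
`¬ (f(x_1, …, x_k) = y)`, with `f ∈ F`; all `¬ (x = y)` with `x`, `y` distinct are conjuncts; and for
all `f ∈ F` and `x_1, …, x_k, y` one of `f(x_1, …, x_k) = y` and its negation is a conjunct.
(The conjunction is finite when `F` and `X` are.) -/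
structure IsDiagramFormula {X : Type*} (F : Set (Σ k, L.Functions k)) (D : Set (L.Formula X)) :
    Prop where
  literal : ∀ φ ∈ D, (∃ x y : X, x ≠ y ∧ φ = varNe x y) ∨
    ∃ (k : ℕ) (f : L.Functions k) (x : Fin k → X) (y : X),
      (⟨k, f⟩ : Σ k, L.Functions k) ∈ F ∧ (φ = funEq f x y ∨ φ = (funEq f x y).not)
  varNe_mem : ∀ x y : X, x ≠ y → varNe x y ∈ D
  complete : ∀ (k : ℕ) (f : L.Functions k) (x : Fin k → X) (y : X),
    (⟨k, f⟩ : Σ k, L.Functions k) ∈ F → funEq f x y ∈ D ∨ (funEq f x y).not ∈ D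

/-- A direct system of diagram-formulas over `B`, indexed by a directed set `I`: formulas
`φ_i` in finitely many variables `X_i` and in finite reducts of `L`, all realized in `B`, with
compatible maps of variables `X_i → X_j` for `i ≤ j` that take conjuncts of `φ_i` to conjuncts of
`φ_j`, and such that each value of each operation on variables is eventually prescribed. -/
structure DirectSystemOver (L : FirstOrder.Language.{u, v}) (B : Type w) [L.Structure B] (I : Type*)
    [PartialOrder I] where
  /-- the variables of the `i`-th formula -/
  X : I → Type w'
  finite_X : ∀ i, Finite (X i)
  /-- the function symbols of the `i`-th finite reduct -/
  reduct : I → Set (Σ k, L.Functions k)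
  finite_reduct : ∀ i, (reduct i).Finite
  reduct_mono : Monotone reduct
  /-- the conjuncts of the `i`-th formula -/
  formula : ∀ i, Set (L.Formula (X i))
  isDiagramFormula : ∀ i, IsDiagramFormula (reduct i) (formula i)
  realized : ∀ i, ∃ b : X i → B, ∀ φ ∈ formula i, φ.Realize b
  /-- the transition maps on variables -/
  map : ∀ {i j : I}, i ≤ j → X i → X j
  map_self : ∀ (i : I) (x : X i), map le_rfl x = x
  map_map : ∀ {i j k : I} (hij : i ≤ j) (hjk : j ≤ k) (x : X i),
    map hjk (map hij x) = map (hij.trans hjk) x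
  map_formula : ∀ {i j : I} (h : i ≤ j), ∀ φ ∈ formula i, φ.relabel (map h) ∈ formula j
  exists_value : ∀ (i : I) (k : ℕ) (f : L.Functions k) (x : Fin k → X i),
    ∃ (j : I) (h : i ≤ j) (y : X j), funEq f (fun a => map h (x a)) y ∈ formula j

namespace DirectSystemOver

variable {B : Type w} [L.Structure B] {I : Type*} [PartialOrder I] [IsDirectedOrder I]
  (Λ : DirectSystemOver.{u, v, w, w'} L B I)

/-- Variables `x ∈ X_i` and `y ∈ X_j` are identified if they have the same image in some `X_k`. -/
@[reducible] def setoid : Setoid (Σ i, Λ.X i) where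
  r x y := ∃ (k : I) (hx : x.1 ≤ k) (hy : y.1 ≤ k), Λ.map hx x.2 = Λ.map hy y.2
  iseqv :=
    ⟨fun x => ⟨x.1, le_rfl, le_rfl, rfl⟩, fun ⟨k, hx, hy, h⟩ => ⟨k, hy, hx, h.symm⟩,
      fun ⟨k, hx, hy, h⟩ ⟨l, hy', hz, h'⟩ => by
        obtain ⟨m, hkm, hlm⟩ := exists_ge_ge k l
        refine ⟨m, hx.trans hkm, hz.trans hlm, ?_⟩
        rw [← Λ.map_map hx hkm, h, Λ.map_map, ← Λ.map_map hz hlm, ← h', Λ.map_map]⟩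

/-- The universe of the limit algebra of the system. -/
def Limit : Type _ := Quotient Λ.setoid

variable {Λ} in
/-- The element of the limit algebra given by a variable `x ∈ X_i`. -/
def toLimit {i : I} (x : Λ.X i) : Λ.Limit := Quotient.mk Λ.setoid ⟨i, x⟩

theorem toLimit_map {i j : I} (h : i ≤ j) (x : Λ.X i) : toLimit (Λ.map h x) = toLimit x :=
  Quotient.sound ⟨j, le_rfl, h, Λ.map_self _ _⟩

theorem toLimit_eq_toLimit {i j : I} (x : Λ.X i) (y : Λ.X j) :
    toLimit x = toLimit y ↔ ∃ (k : I) (hx : i ≤ k) (hy : j ≤ k), Λ.map hx x = Λ.map hy y :=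
  Quotient.eq (r := Λ.setoid)

theorem relabel_funEq {X Y : Type*} (g : X → Y) {k : ℕ} (f : L.Functions k) (x : Fin k → X)
    (y : X) : (funEq f x y).relabel g = funEq f (fun a => g (x a)) (g y) := rfl

theorem relabel_varNe {X Y : Type*} (g : X → Y) (x y : X) :
    (varNe x y : L.Formula X).relabel g = varNe (g x) (g y) := rfl

theorem exists_rep [Nonempty I] {k : ℕ} (z : Fin k → Λ.Limit) :
    ∃ (i : I) (x : Fin k → Λ.X i), ∀ a, toLimit (x a) = z a := by
  have h : ∀ a, ∃ x : Σ i, Λ.X i, Quotient.mk Λ.setoid x = z a := fun a => Quotient.exists_rep _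
  choose x hx using h
  obtain ⟨i, hi⟩ := Finite.bddAbove_range fun a => (x a).1
  exact ⟨i, fun a => Λ.map (hi ⟨a, rfl⟩) (x a).2, fun a => (Λ.toLimit_map _ _).trans (hx a)⟩

theorem exists_funEq [Nonempty I] {k : ℕ} (f : L.Functions k) (z : Fin k → Λ.Limit) :
    ∃ (c : Λ.Limit) (i : I) (x : Fin k → Λ.X i) (y : Λ.X i),
      (∀ a, toLimit (x a) = z a) ∧ toLimit y = c ∧ funEq f x y ∈ Λ.formula i := by
  obtain ⟨i, x, hx⟩ := Λ.exists_rep z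
  obtain ⟨j, h, y, hy⟩ := Λ.exists_value i k f x
  exact ⟨toLimit y, j, _, y, fun a => (Λ.toLimit_map h _).trans (hx a), rfl, hy⟩

/-- The limit algebra of the system: `f(z_1, …, z_k) = c` whenever `f(x_1, …, x_k) = y` is a conjunct
of some `φ_i` and `x_1, …, x_k, y` represent `z_1, …, z_k, c`. (See `funMap_toLimit`: the value does not
depend on the choice.) -/
noncomputable instance [L.IsAlgebraic] [Nonempty I] : L.Structure Λ.Limit where
  funMap f z := Classical.choose (Λ.exists_funEq f z)
  RelMap r _ := isEmptyElim r

theorem funMap_toLimit [L.IsAlgebraic] [Nonempty I] {k : ℕ} (f : L.Functions k) {i : I}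
    (x : Fin k → Λ.X i) (y : Λ.X i) (h : funEq f x y ∈ Λ.formula i) :
    Structure.funMap f (fun a => toLimit (x a)) = toLimit y := by
  obtain ⟨j, x', y', hx, hy, h'⟩ := Classical.choose_spec (Λ.exists_funEq f fun a => toLimit (x a))
  refine hy.symm.trans ?_
  simp only [toLimit_eq_toLimit] at hx
  choose l h₁ h₂ hl using hx
  obtain ⟨m, hm⟩ := Finite.bddAbove_range l
  obtain ⟨m', hmm', him'⟩ := exists_ge_ge m i
  obtain ⟨q, hmq, hjq⟩ := exists_ge_ge m' j
  have hlq : ∀ a, l a ≤ q := fun a => (hm ⟨a, rfl⟩).trans (hmm'.trans hmq)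
  have hiq := him'.trans hmq
  have hx : (fun a => Λ.map hjq (x' a)) = fun a => Λ.map hiq (x a) := by
    funext a
    rw [← Λ.map_map (h₁ a) (hlq a), hl a, Λ.map_map]
  refine (Λ.toLimit_eq_toLimit _ _).2 ⟨q, hjq, hiq, ?_⟩
  have e := Λ.map_formula hiq _ h
  have e' := Λ.map_formula hjq _ h'
  rw [relabel_funEq] at e e'
  rw [hx] at e'
  obtain ⟨b, hb⟩ := Λ.realized q
  by_contra hne
  have h1 := hb _ e
  have h2 := hb _ e'
  have h3 := hb _ ((Λ.isDiagramFormula q).varNe_mem _ _ hne)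
  simp only [funEq, varNe, Formula.realize_equal, Formula.realize_not] at h1 h2 h3
  exact h3 (h2.symm.trans h1)

end DirectSystemOver

/-- `C` is a limit algebra over `B`: it is isomorphic to the limit algebra of a direct system of
diagram-formulas over `B`. -/
def IsLimitAlgebraOver (L : FirstOrder.Language.{u, v}) [L.IsAlgebraic] (C : Type w') (B : Type w)
    [L.Structure C] [L.Structure B] : Prop :=
  ∃ (I : Type (max u w')) (_ : PartialOrder I) (_ : IsDirectedOrder I) (_ : Nonempty I)
    (Λ : DirectSystemOver.{u, v, w, w'} L B I), Nonempty (C ≃[L] Λ.Limit)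

end Limits

end UAG

open UAG

/-! Fix generators `c` of `C` and let `S` be the set of all equations true at `c`. Homomorphisms `C
→ B` are the same thing as solutions of `S` in `B`, and `C` is determined up to isomorphism by `S`.
This translates between homomorphisms, points of algebraic sets and atomic types.

Conditions 1, 2, 3, 5, 6 agree for every `B` and finitely generated `C`: realizing finite pieces of
the diagram of `C` in `B` is an existential matter, and such realizations glue along an ultrafilter.
Conditions 4 and 7 also agree for every `B`, and 4 implies 3. Compactness enters only in 1 → 4
(`isDiscriminatedBy_of_universalTheory_subset`): if every solution of `S` identified two of finitely
many given elements, a finite `S₀ ⊆ S` would already force this, and that universal statement would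
pass from `B` to `C`, where `c` refutes it.

Conversely, a failure of compactness yields, by an ultraproduct of counterexamples, a finitely
generated subalgebra of an ultrapower of `B` that `B` does not discriminate
(`isUOmegaCompact_of_forall_isDiscriminatedBy`). -/

namespace UAG

/-! ### Maps determined by generators and relations. -/

section Generators

variable {L : FirstOrder.Language.{u, v}}

/-- `c` is a family of generators of `M`: every element of `M` is the value of a term at `c`. -/
def IsGeneratingFamily (L : FirstOrder.Language.{u, v}) {X M : Type*} [L.Structure M]
    (c : X → M) : Prop :=
  ∀ x, ∃ t : L.Term X, t.realize c = x

theorem exists_isGeneratingFamily {M : Type*} [L.Structure M] (h : Structure.FG L M) :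
    ∃ (n : ℕ) (c : Fin n → M), IsGeneratingFamily L c := by
  obtain ⟨n, c, hc⟩ := Substructure.fg_iff_exists_fin_generating_family.1 h.out
  refine ⟨n, c, fun x => ?_⟩
  have hx : x ∈ Substructure.closure L (Set.range c) := hc ▸ Substructure.mem_top x
  obtain ⟨t, ht⟩ := Substructure.mem_closure_iff_exists_term.1 hx
  -- The term `t` has its variables in `Set.range c`; an index is chosen for each of them.
  choose g hg using fun y : Set.range c => y.2
  refine ⟨t.relabel g, ?_⟩
  rw [Term.realize_relabel, ← ht]
  exact congrArg (fun v => t.realize v) (funext hg)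

theorem IsGeneratingFamily.fg {M : Type*} [L.Structure M] {n : ℕ} {c : Fin n → M}
    (hc : IsGeneratingFamily L c) : Structure.FG L M := by
  refine ⟨Substructure.fg_iff_exists_fin_generating_family.2 ⟨n, c, ?_⟩⟩
  refine eq_top_iff.2 fun x _ => ?_
  obtain ⟨t, rfl⟩ := hc x
  exact t.realize_mem _ fun i => Substructure.subset_closure ⟨i, rfl⟩

theorem TermCongruence.toFactor_eq_iff {X : Type*} (θ : TermCongruence L X) {t s : L.Term X} :
    θ.toFactor t = θ.toFactor s ↔ θ.toSetoid t s :=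
  Quotient.eq (r := θ.toSetoid)

variable [L.IsAlgebraic] {X : Type*} {M N : Type*} [L.Structure M] [L.Structure N]

/-- The assignment `t(c) ↦ t(b)` is well defined by `h`. This is how a solution of the relations of
`M` becomes a homomorphism. -/
theorem IsGeneratingFamily.exists_hom {c : X → M} (hc : IsGeneratingFamily L c) (b : X → N)
    (h : ∀ t s : L.Term X, t.realize c = s.realize c → t.realize b = s.realize b) :
    ∃ f : M →[L] N, ∀ t : L.Term X, f (t.realize c) = t.realize b := by
  choose τ hτ using hc
  refine ⟨⟨fun x => (τ x).realize b, fun {k} f x => ?_, fun {_} r => isEmptyElim r⟩,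
    fun t => h _ _ (hτ _)⟩
  refine h (τ _) (Term.func f fun i => τ (x i)) ?_
  rw [hτ, Term.realize_func]
  simp only [hτ]

theorem IsGeneratingFamily.exists_embedding {c : X → M} (hc : IsGeneratingFamily L c) (b : X → N)
    (h : ∀ t s : L.Term X, t.realize c = s.realize c ↔ t.realize b = s.realize b) :
    ∃ f : M ↪[L] N, ∀ t : L.Term X, f (t.realize c) = t.realize b := by
  obtain ⟨f, hf⟩ := hc.exists_hom b fun t s => (h t s).1
  have hinj : Function.Injective f := fun x y hxy => by
    obtain ⟨t, rfl⟩ := hc x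
    obtain ⟨s, rfl⟩ := hc y
    rw [hf, hf] at hxy
    exact (h t s).2 hxy
  exact ⟨Embedding.ofInjective hinj, hf⟩

theorem IsGeneratingFamily.nonempty_equiv {c : X → M} (hc : IsGeneratingFamily L c) {b : X → N}
    (hb : IsGeneratingFamily L b)
    (h : ∀ t s : L.Term X, t.realize c = s.realize c ↔ t.realize b = s.realize b) :
    Nonempty (M ≃[L] N) := by
  obtain ⟨f, hf⟩ := hc.exists_embedding b h
  have hsurj : Function.Surjective f := fun y => by
    obtain ⟨t, rfl⟩ := hb y
    exact ⟨_, hf t⟩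
  exact ⟨⟨Equiv.ofBijective f ⟨f.injective, hsurj⟩, fun g x => f.map_fun g x,
    fun r x => f.map_rel r x⟩⟩

/-- The congruence of all pairs of terms with equal values at `c`. -/
def kernelCongruence (c : X → M) : TermCongruence L X where
  r t s := t.realize c = s.realize c
  iseqv := ⟨fun _ => rfl, Eq.symm, Eq.trans⟩
  func_congr f ts ss h := by
    change Structure.funMap f _ = Structure.funMap f _
    exact congrArg _ (funext h)

theorem TermCongruence.realize_var (θ : TermCongruence L X) (t : L.Term X) :
    t.realize (fun x => θ.toFactor (Term.var x)) = θ.toFactor t := by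
  induction t with
  | var => rfl
  | func f ts ih =>
    rw [Term.realize_func]
    simp only [ih]
    exact θ.funMap_toFactor f ts

theorem TermCongruence.isGeneratingFamily (θ : TermCongruence L X) :
    IsGeneratingFamily L fun x => θ.toFactor (Term.var x) := fun x => by
  obtain ⟨t, rfl⟩ := Quotient.exists_rep x
  exact ⟨t, θ.realize_var t⟩

theorem TermCongruence.realize_var_eq_iff (θ : TermCongruence L X) {t s : L.Term X} :
    t.realize (fun x => θ.toFactor (Term.var x)) = s.realize (fun x => θ.toFactor (Term.var x)) ↔
      θ.toSetoid t s := by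
  rw [θ.realize_var, θ.realize_var, θ.toFactor_eq_iff]

theorem IsGeneratingFamily.nonempty_equiv_factor {c : X → M} (hc : IsGeneratingFamily L c)
    (θ : TermCongruence L X)
    (h : ∀ t s : L.Term X, t.realize c = s.realize c ↔ θ.toSetoid t s) :
    Nonempty (M ≃[L] θ.Factor) :=
  hc.nonempty_equiv θ.isGeneratingFamily fun t s => (h t s).trans θ.realize_var_eq_iff.symm

end Generators

/-! ### Universal and existential sentences. -/

section Sentences

variable {L : FirstOrder.Language.{u, v}}

theorem isQF_equal {X : Type*} (t s : L.Term X) : (t.equal s).IsQF :=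
  (BoundedFormula.IsAtomic.equal _ _).isQF

theorem isQF_foldr_inf {X : Type*} {n : ℕ} (l : List (L.BoundedFormula X n))
    (h : ∀ φ ∈ l, φ.IsQF) : (l.foldr (· ⊓ ·) ⊤).IsQF := by
  induction l with
  | nil => exact BoundedFormula.IsQF.top
  | cons φ l ih =>
    exact (h φ (by simp)).inf (ih fun ψ hψ => h ψ (by simp [hψ]))

theorem isUniversal_alls {X : Type*} {n : ℕ} {φ : L.BoundedFormula X n} (h : φ.IsUniversal) :
    φ.alls.IsUniversal := by
  induction n with
  | zero => exact h
  | succ n ih => exact ih h.all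

/-- The formula `φ.not` need not have universal form syntactically, so the negation is pushed
through the quantifiers. The equivalence appears twice because one `ψ` has to serve structures in
two universes. -/
theorem exists_isUniversal_realize_iff_not {X : Type*} {n : ℕ} {φ : L.BoundedFormula X n}
    (h : φ.IsExistential) :
    ∃ ψ : L.BoundedFormula X n, ψ.IsUniversal ∧
      (∀ (M : Type w) [L.Structure M] (v : X → M) (xs : Fin n → M),
        ψ.Realize v xs ↔ ¬ φ.Realize v xs) ∧
      ∀ (M : Type w') [L.Structure M] (v : X → M) (xs : Fin n → M),
        ψ.Realize v xs ↔ ¬ φ.Realize v xs := by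
  induction h with
  | of_isQF h => exact ⟨_, h.not.isUniversal, by simp, by simp⟩
  | ex h ih =>
    obtain ⟨ψ, h1, h2, h3⟩ := ih
    exact ⟨_, h1.all, by simp [h2], by simp [h3]⟩

theorem exists_isExistential_realize_iff_not {X : Type*} {n : ℕ} {φ : L.BoundedFormula X n}
    (h : φ.IsUniversal) :
    ∃ ψ : L.BoundedFormula X n, ψ.IsExistential ∧
      (∀ (M : Type w) [L.Structure M] (v : X → M) (xs : Fin n → M),
        ψ.Realize v xs ↔ ¬ φ.Realize v xs) ∧
      ∀ (M : Type w') [L.Structure M] (v : X → M) (xs : Fin n → M),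
        ψ.Realize v xs ↔ ¬ φ.Realize v xs := by
  induction h with
  | of_isQF h => exact ⟨_, h.not.isExistential, by simp, by simp⟩
  | all h ih =>
    obtain ⟨ψ, h1, h2, h3⟩ := ih
    exact ⟨_, h1.ex, by simp [h2], by simp [h3]⟩

variable {B : Type w} {C : Type w'} [L.Structure B] [L.Structure C]

theorem universalTheory_subset_iff :
    universalTheory L B ⊆ universalTheory L C ↔ existentialTheory L C ⊆ existentialTheory L B := by
  constructor
  · rintro h φ ⟨hφ, hC⟩
    obtain ⟨ψ, h1, h2, h3⟩ := exists_isUniversal_realize_iff_not.{u, v, w, w'} hφ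
    by_contra hB
    exact (h3 C _ _).1 (h ⟨h1, (h2 B _ _).2 fun h' => hB ⟨hφ, h'⟩⟩).2 hC
  · rintro h φ ⟨hφ, hB⟩
    obtain ⟨ψ, h1, h2, h3⟩ := exists_isExistential_realize_iff_not.{u, v, w, w'} hφ
    by_contra hC
    exact (h2 B _ _).1 (h ⟨h1, (h3 C _ _).2 fun h' => hC ⟨hφ, h'⟩⟩).2 hB

theorem universalTheory_subset_of_embedding (f : C ↪[L] B) :
    universalTheory L B ⊆ universalTheory L C := fun φ ⟨hφ, hB⟩ => by
  refine ⟨hφ, hφ.realize_embedding f ?_⟩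
  have e (v : Empty → B) (xs : Fin 0 → B) : BoundedFormula.Realize φ v xs ↔ B ⊨ φ := by
    rw [Subsingleton.elim v default, Subsingleton.elim xs default]
    rfl
  exact (e _ _).2 hB

/-- Łoś's theorem, followed by the passage of universal sentences to substructures. -/
theorem universalTheory_subset_of_embedsInUltrapower [Nonempty B] (h : EmbedsInUltrapower L C B) :
    universalTheory L B ⊆ universalTheory L C := by
  obtain ⟨I, U, ⟨f⟩⟩ := h
  refine subset_trans ?_ (universalTheory_subset_of_embedding f)
  exact fun φ ⟨hφ, hB⟩ => ⟨hφ, (Ultraproduct.sentence_realize φ).2 (.of_forall fun _ => hB)⟩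

/-- A finite set of quantifier-free formulas that is realized in `C` is realized in `B`
if every universal sentence true in `B` is true in `C`. -/
theorem exists_realize_of_universalTheory_subset (h : universalTheory L B ⊆ universalTheory L C)
    {X : Type*} [Finite X] {D : Set (L.Formula X)} (hD : D.Finite) (hqf : ∀ φ ∈ D, φ.IsQF)
    {c : X → C} (hc : ∀ φ ∈ D, φ.Realize c) : ∃ b : X → B, ∀ φ ∈ D, φ.Realize b := by
  obtain ⟨n, ⟨e⟩⟩ := Finite.exists_equiv_fin X
  let θ : L.Formula X := hD.toFinset.toList.foldr (· ⊓ ·) ⊤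
  have hθ {M : Type _} [L.Structure M] (v : X → M) : θ.Realize v ↔ ∀ φ ∈ D, φ.Realize v := by
    simp [θ, Formula.Realize, BoundedFormula.realize_foldr_inf]
  -- A local fact has fixed universes: `hθ` is used for `B` and `hθ'` for `C`.
  have hθ' {M : Type _} [L.Structure M] (v : X → M) : θ.Realize v ↔ ∀ φ ∈ D, φ.Realize v := by
    simp [θ, Formula.Realize, BoundedFormula.realize_foldr_inf]
  -- The free variables become bound ones, so that `χ.not.alls` is a sentence.
  let χ : L.BoundedFormula Empty n := BoundedFormula.relabel Sum.inr (θ.relabel e)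
  have hχqf : χ.IsQF := by
    refine BoundedFormula.IsQF.relabel (BoundedFormula.IsQF.relabel ?_ _) _
    exact isQF_foldr_inf _ fun φ hφ => hqf φ (by simpa using hφ)
  by_contra hB
  have key : χ.not.alls ∈ universalTheory L B := by
    refine ⟨isUniversal_alls hχqf.not.isUniversal, BoundedFormula.realize_alls.2 fun x hx => ?_⟩
    refine hB ⟨x ∘ e, (hθ _).1 ?_⟩
    exact Formula.realize_relabel.1 ((Formula.realize_relabel_sumInr _).1 hx)
  refine BoundedFormula.realize_alls.1 (h key).2 (c ∘ e.symm) ?_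
  refine (Formula.realize_relabel_sumInr _).2 (Formula.realize_relabel.2 ?_)
  rw [Function.comp_assoc, e.symm_comp_self]
  exact (hθ' _).2 hc

end Sentences

/-! ### Embeddings into ultrapowers. -/

section UltrapowerEmbeddings

variable {L : FirstOrder.Language.{u, v}} {B : Type w} {C : Type w'} [L.Structure B] [L.Structure C]

/-- An ultrafilter on a directed set that contains all sets `{j | i ≤ j}`. -/
theorem exists_ultrafilter_eventually_ge (I : Type*) [Preorder I] [IsDirectedOrder I]
    [Nonempty I] : ∃ U : Ultrafilter I, ∀ i, ∀ᶠ j in (U : Filter I), i ≤ j :=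
  ⟨Ultrafilter.of Filter.atTop, fun i =>
    Ultrafilter.of_le Filter.atTop (Filter.eventually_ge_atTop i)⟩

theorem mk_product_eq_iff {I : Type*} {U : Ultrafilter I} {x y : I → B} :
    ((x : (U : Filter I).Product fun _ => B) = (y : (U : Filter I).Product fun _ => B)) ↔ ∀ᶠ i in (U : Filter I), x i = y i :=
  Quotient.eq (r := (U : Filter I).productSetoid fun _ => B)

/-- A family of maps from `C` to `B` such that almost all of them preserve any given value of an
operation and almost all of them separate any two given points induces an embedding of `C` into an
ultrapower of `B`. -/
theorem embedsInUltrapower_of_family [L.IsAlgebraic] {I : Type (max u w')} (U : Ultrafilter I)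
    (g : I → C → B)
    (hfun : ∀ (k : ℕ) (f : L.Functions k) (x : Fin k → C),
      ∀ᶠ i in (U : Filter I), g i (Structure.funMap f x) = Structure.funMap f (g i ∘ x))
    (hinj : ∀ x y, x ≠ y → ∀ᶠ i in (U : Filter I), g i x ≠ g i y) :
    EmbedsInUltrapower L C B := by
  let F : C →[L] (U : Filter I).Product fun _ => B :=
    ⟨fun x => ((fun i => g i x : I → B) : (U : Filter I).Product fun _ => B), fun {k} f x => by
      refine Eq.trans ?_ (Ultraproduct.funMap_cast f fun a i => g i (x a)).symm
      exact mk_product_eq_iff.2 (hfun k f x), fun {_} r => isEmptyElim r⟩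
  refine ⟨I, U, ⟨Embedding.ofInjective (f := F) fun x y hxy => ?_⟩⟩
  by_contra hne
  obtain ⟨i, h1, h2⟩ := ((mk_product_eq_iff.1 hxy).and (hinj x y hne)).exists
  exact h2 h1

/-- Homomorphisms injective on ever larger finite sets are glued along an ultrafilter on the finite
subsets of `C`. -/
theorem IsDiscriminatedBy.embedsInUltrapower [L.IsAlgebraic] (h : IsDiscriminatedBy L C B) :
    EmbedsInUltrapower L C B := by
  classical
  -- The lift puts the index set in `Type (max u w')`, as `EmbedsInUltrapower` demands.
  choose g hg using fun W : ULift.{u} (Finset C) => h (W.down : Set C) W.down.finite_toSet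
  obtain ⟨U, hU⟩ := exists_ultrafilter_eventually_ge (ULift.{u} (Finset C))
  refine embedsInUltrapower_of_family U (fun W => g W)
    (fun k f x => .of_forall fun W => (g W).map_fun f x) fun x y hne => ?_
  filter_upwards [hU ⟨{x, y}⟩] with W hW
  have hW' : ({x, y} : Finset C) ⊆ W.down := hW
  exact (hg W).ne (hW' (by simp)) (hW' (by simp)) hne

end UltrapowerEmbeddings

/-! ### Limit algebras and finite parts of the diagram. -/

section LimitAlgebras

variable {L : FirstOrder.Language.{u, v}} {B : Type w} {C : Type w'}
  [L.Structure B] [L.Structure C]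

/-- Realizations of the formulas `φ_i` are glued along an ultrafilter on `I`: the conjuncts `f(x) =
y` make the glued map a homomorphism, the conjuncts `¬ (x = y)` make it injective. -/
theorem IsLimitAlgebraOver.embedsInUltrapower [L.IsAlgebraic] [Nonempty B] (h : IsLimitAlgebraOver L C B) :
    EmbedsInUltrapower L C B := by
  classical
  obtain ⟨I, _, _, _, Λ, ⟨e⟩⟩ := h
  choose b hb using Λ.realized
  obtain ⟨U, hU⟩ := exists_ultrafilter_eventually_ge I
  have hrep : ∀ z : C, ∃ x : Σ i, Λ.X i, DirectSystemOver.toLimit x.2 = e z := fun z =>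
    Quotient.exists_rep _
  choose ρ hρ using hrep
  -- The default value is harmless: almost every `i` lies above the index of the chosen
  -- representative of `z`.
  let g (i : I) (z : C) : B :=
    if h : (ρ z).1 ≤ i then b i (Λ.map h (ρ z).2) else Classical.arbitrary B
  -- Almost all `g i` take `z` to the value of any variable that represents `z`.
  have hg (z : C) {j : I} (x : Λ.X j) (hx : DirectSystemOver.toLimit x = e z) :
      ∀ᶠ i in (U : Filter I), ∃ h : j ≤ i, g i z = b i (Λ.map h x) := by
    obtain ⟨k, h1, h2, h3⟩ := (Λ.toLimit_eq_toLimit _ _).1 (hx.trans (hρ z).symm)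
    filter_upwards [hU k] with i hi
    refine ⟨h1.trans hi, ?_⟩
    simp only [g, dif_pos (h2.trans hi)]
    rw [← Λ.map_map h1 hi, h3, Λ.map_map]
  refine embedsInUltrapower_of_family U g (fun k f z => ?_) fun z z' hne => ?_
  · obtain ⟨c, j, x, y, hx, rfl, hf⟩ := Λ.exists_funEq f (e ∘ z)
    have hy : DirectSystemOver.toLimit y = e (Structure.funMap f z) := by
      rw [e.map_fun, ← Λ.funMap_toLimit f x y hf]
      exact congrArg _ (funext hx)
    filter_upwards [hg _ y hy, Filter.eventually_all.2 fun a => hg (z a) (x a) (hx a)] with i h1 h2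
    obtain ⟨hji, h1⟩ := h1
    have := hb i _ (Λ.map_formula hji _ hf)
    rw [DirectSystemOver.relabel_funEq] at this
    simp only [funEq, Formula.realize_equal, Term.realize_func, Term.realize_var] at this
    rw [h1, ← this]
    exact congrArg _ (funext fun a => (h2 a).2.symm)
  · filter_upwards [hg z _ (hρ z), hg z' _ (hρ z')] with i ⟨h1, h1'⟩ ⟨h2, h2'⟩
    rw [h1', h2']
    have hne' : Λ.map h1 (ρ z).2 ≠ Λ.map h2 (ρ z').2 := fun h =>
      hne (e.injective ((hρ z).symm.trans
        (((Λ.toLimit_eq_toLimit _ _).2 ⟨i, h1, h2, h⟩).trans (hρ z'))))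
    have := hb i _ ((Λ.isDiagramFormula i).varNe_mem _ _ hne')
    simpa [varNe] using this

/-- The literals in the variables `W ⊆ C` and the function symbols `F` that are true in `C`. -/
def diagram (W : Set C) (F : Set (Σ k, L.Functions k)) : Set (L.Formula W) :=
  {φ | φ.Realize (fun x : W => (x : C)) ∧ ((∃ x y : W, x ≠ y ∧ φ = varNe x y) ∨
    ∃ (k : ℕ) (f : L.Functions k) (x : Fin k → W) (y : W),
      (⟨k, f⟩ : Σ k, L.Functions k) ∈ F ∧ (φ = funEq f x y ∨ φ = (funEq f x y).not))}

theorem isQF_of_mem_diagram {W : Set C} {F : Set (Σ k, L.Functions k)} {φ : L.Formula W}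
    (h : φ ∈ diagram W F) : φ.IsQF := by
  obtain ⟨-, ⟨x, y, -, rfl⟩ | ⟨k, f, x, y, -, rfl | rfl⟩⟩ := h
  · exact (isQF_equal _ _).not
  · exact isQF_equal _ _
  · exact (isQF_equal _ _).not

theorem finite_diagram {W : Set C} (hW : W.Finite) {F : Set (Σ k, L.Functions k)}
    (hF : F.Finite) : (diagram W F).Finite := by
  have := hW.to_subtype
  have := hF.to_subtype
  refine ((Set.finite_range fun p : W × W => varNe p.1 p.2).union
    ((Set.finite_range fun p : Σ f : F, (Fin f.1.1 → W) × W => funEq p.1.1.2 p.2.1 p.2.2).union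
    (Set.finite_range fun p : Σ f : F, (Fin f.1.1 → W) × W =>
      (funEq p.1.1.2 p.2.1 p.2.2).not))).subset ?_
  rintro φ ⟨-, ⟨x, y, -, rfl⟩ | ⟨k, f, x, y, hf, rfl | rfl⟩⟩
  · exact .inl ⟨(x, y), rfl⟩
  · exact .inr (.inl ⟨⟨⟨_, hf⟩, x, y⟩, rfl⟩)
  · exact .inr (.inr ⟨⟨⟨_, hf⟩, x, y⟩, rfl⟩)

theorem isDiagramFormula_diagram (W : Set C) (F : Set (Σ k, L.Functions k)) :
    IsDiagramFormula F (diagram W F) where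
  literal _ hφ := hφ.2
  varNe_mem x y hne := by
    refine ⟨?_, .inl ⟨x, y, hne, rfl⟩⟩
    simpa [varNe, Subtype.ext_iff] using hne
  complete k f x y hf := by
    by_cases h : (funEq f x y).Realize (fun x : W => (x : C))
    · exact .inl ⟨h, .inr ⟨k, f, x, y, hf, .inl rfl⟩⟩
    · exact .inr ⟨h, .inr ⟨k, f, x, y, hf, .inr rfl⟩⟩

theorem relabel_mem_diagram {W W' : Set C} {F F' : Set (Σ k, L.Functions k)} (hW : W ⊆ W')
    (hF : F ⊆ F') {φ : L.Formula W} (h : φ ∈ diagram W F) :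
    φ.relabel (Set.inclusion hW) ∈ diagram W' F' := by
  refine ⟨Formula.realize_relabel.2 h.1, ?_⟩
  obtain ⟨-, ⟨x, y, hne, rfl⟩ | ⟨k, f, x, y, hf, rfl | rfl⟩⟩ := h
  · exact .inl ⟨_, _, (Set.inclusion_injective hW).ne hne, rfl⟩
  · exact .inr ⟨k, f, _, _, hF hf, .inl rfl⟩
  · exact .inr ⟨k, f, _, _, hF hf, .inr rfl⟩

/-- The direct system of the finite parts of the diagram of `C`. -/
def diagramSystem (h : universalTheory L B ⊆ universalTheory L C) :
    DirectSystemOver.{u, v, w, w'} L B (Finset C × Finset (Σ k, L.Functions k)) where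
  X i := (i.1 : Set C)
  finite_X i := i.1.finite_toSet
  reduct i := i.2
  finite_reduct i := i.2.finite_toSet
  reduct_mono _ _ hij := Finset.coe_subset.2 hij.2
  formula i := diagram (i.1 : Set C) (i.2 : Set (Σ k, L.Functions k))
  isDiagramFormula i := isDiagramFormula_diagram _ _
  -- The only place where `h` is used.
  realized i :=
    have : Finite (i.1 : Set C) := i.1.finite_toSet
    exists_realize_of_universalTheory_subset h
      (finite_diagram i.1.finite_toSet i.2.finite_toSet) (fun _ => isQF_of_mem_diagram)
      fun _ hφ => hφ.1
  map hij := Set.inclusion (Finset.coe_subset.2 hij.1)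
  map_self _ _ := rfl
  map_map _ _ _ := rfl
  map_formula hij _ hφ := relabel_mem_diagram _ (Finset.coe_subset.2 hij.2) hφ
  exists_value i k f x := by
    classical
    refine ⟨(insert (Structure.funMap f fun a => (x a : C)) i.1, insert ⟨k, f⟩ i.2),
      ⟨Finset.subset_insert _ _, Finset.subset_insert _ _⟩,
      ⟨Structure.funMap f fun a => (x a : C), by simp⟩, ?_, .inr ⟨k, f, _, _, by simp, .inl rfl⟩⟩
    simp [funEq]

/-- The transition maps are inclusions of finite subsets of `C`, so the limit is their union `C`,
with the operations read off the diagram. -/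
theorem isLimitAlgebraOver_of_universalTheory_subset [L.IsAlgebraic]
    (h : universalTheory L B ⊆ universalTheory L C) : IsLimitAlgebraOver L C B := by
  classical
  refine ⟨Finset C × Finset (Σ k, L.Functions k), inferInstance, inferInstance, inferInstance,
    diagramSystem h, ?_⟩
  let g (x : C) : (diagramSystem h).Limit :=
    DirectSystemOver.toLimit (i := ({x}, ∅)) ⟨x, by simp⟩
  have hg {i} (x : (diagramSystem h).X i) : g x.1 = DirectSystemOver.toLimit x := by
    refine (DirectSystemOver.toLimit_eq_toLimit _ _ _).2 ⟨i, ?_, le_rfl, rfl⟩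
    exact ⟨Finset.singleton_subset_iff.2 x.2, Finset.empty_subset _⟩
  have hinj : Function.Injective g := fun x y hxy => by
    obtain ⟨k, h1, h2, h3⟩ := (DirectSystemOver.toLimit_eq_toLimit _ _ _).1 hxy
    exact congrArg Subtype.val h3
  have hsurj : Function.Surjective g := fun z => by
    obtain ⟨⟨i, x⟩, rfl⟩ := Quotient.exists_rep z
    exact ⟨x.1, hg x⟩
  refine ⟨⟨Equiv.ofBijective g ⟨hinj, hsurj⟩, fun {k} f x => ?_, fun {_} r => isEmptyElim r⟩⟩
  -- An index large enough to hold `f`, its arguments and its value.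
  let i : Finset C × Finset (Σ k, L.Functions k) :=
    (insert (Structure.funMap f x) (Finset.univ.image x), {⟨k, f⟩})
  let x' (a : Fin k) : (diagramSystem h).X i := ⟨x a, by simp [i]⟩
  let y : (diagramSystem h).X i := ⟨Structure.funMap f x, by simp [i]⟩
  have hf : funEq f x' y ∈ (diagramSystem h).formula i :=
    ⟨Formula.realize_equal.2 rfl, .inr ⟨k, f, x', y, by simp [i], .inl rfl⟩⟩
  refine (hg y).trans (((diagramSystem h).funMap_toLimit f x' y hf).symm.trans ?_)
  exact congrArg _ (funext fun a => (hg (x' a)).symm)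

end LimitAlgebras

/-! ### Complete atomic types. -/

section AtomicTypes

variable {L : FirstOrder.Language.{u, v}}

/-- All equations and negations of equations that are true at `a`. -/
def atomicTypeOf {M : Type*} [L.Structure M] {n : ℕ} (a : Fin n → M) : Set (L.Formula (Fin n)) :=
  {φ | (∃ t s : L.Term (Fin n), φ = t.equal s ∨ φ = (t.equal s).not) ∧ φ.Realize a}

theorem mem_positivePart_atomicTypeOf {M : Type*} [L.Structure M] {n : ℕ} {a : Fin n → M}
    {t s : L.Term (Fin n)} :
    (t, s) ∈ positivePart (atomicTypeOf a) ↔ t.realize a = s.realize a :=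
  ⟨fun h => Formula.realize_equal.1 h.2, fun h => ⟨⟨t, s, .inl rfl⟩, Formula.realize_equal.2 h⟩⟩

/-- The equations true at a point already form a congruence. Hence the algebra defined by the type
of `a` is a copy of the subalgebra generated by `a`. -/
theorem congruentClosure_positivePart_atomicTypeOf {M : Type*} [L.Structure M] {n : ℕ}
    {a : Fin n → M} {t s : L.Term (Fin n)} :
    CongruentClosure (positivePart (atomicTypeOf a)) t s ↔ t.realize a = s.realize a := by
  refine ⟨fun h => ?_, fun h => .of (mem_positivePart_atomicTypeOf.2 h)⟩
  induction h with
  | of h => exact mem_positivePart_atomicTypeOf.1 h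
  | refl => rfl
  | symm _ ih => exact ih.symm
  | trans _ _ ih ih' => exact ih.trans ih'
  | func f _ ih =>
    rw [Term.realize_func, Term.realize_func]
    exact congrArg _ (funext ih)

/-- The set contains every equation or its negation, so no realizable set of such formulas is
larger. -/
theorem isCompleteAtomicType_atomicTypeOf {T : L.Theory} {M : Type (max u v)} [L.Structure M]
    [Nonempty M] (hM : M ⊨ T) {n : ℕ} (a : Fin n → M) :
    IsCompleteAtomicType T (atomicTypeOf a : Set (L.Formula (Fin n))) := by
  refine ⟨⟨fun φ hφ => hφ.1, M, _, ‹_›, hM, a, fun φ hφ => hφ.2⟩, ?_⟩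
  rintro q ⟨hq, M', _, _, -, a', ha'⟩ hpq φ hφ
  refine ⟨hq φ hφ, ?_⟩
  obtain ⟨t, s, rfl | rfl⟩ := hq φ hφ
  · by_contra hne
    exact ha' _ (hpq ⟨⟨t, s, .inr rfl⟩, hne⟩) (ha' _ hφ)
  · exact fun h => ha' _ hφ (ha' _ (hpq ⟨⟨t, s, .inl rfl⟩, h⟩))

theorem IsCompleteAtomicType.exists_eq_atomicTypeOf {T : L.Theory} {n : ℕ}
    {p : Set (L.Formula (Fin n))} (hp : IsCompleteAtomicType T p) :
    ∃ (M : Type (max u v)) (_ : L.Structure M) (_ : Nonempty M) (a : Fin n → M),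
      M ⊨ T ∧ p = atomicTypeOf a := by
  obtain ⟨hp1, M, _, _, hM, a, ha⟩ := hp.prop
  exact ⟨M, _, ‹_›, a, hM, hp.eq_of_subset
    ⟨fun φ hφ => hφ.1, M, _, ‹_›, hM, a, fun φ hφ => hφ.2⟩ fun φ hφ => ⟨hp1 φ hφ, ha φ hφ⟩⟩

variable [L.IsAlgebraic] {B : Type w} {C : Type w'} [L.Structure B] [L.Structure C]

theorem isDefinedByCompleteAtomicType_of_universalTheory_subset [Nonempty C]
    (hC : Structure.FG L C) (h : universalTheory L B ⊆ universalTheory L C) :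
    IsDefinedByCompleteAtomicType (universalTheory L B) C := by
  obtain ⟨n, c, hc⟩ := exists_isGeneratingFamily hC
  -- Models realizing types are taken in `Type (max u v)`. A quotient of the terms in `n` variables
  -- lies in `Type u`, so after a lift it gives a copy of `C` there.
  obtain ⟨e⟩ := hc.nonempty_equiv_factor (kernelCongruence c) fun _ _ => Iff.rfl
  let M := ULift.{v} (kernelCongruence (L := L) c).Factor
  let e' : C ≃ M := e.toEquiv.trans Equiv.ulift.symm
  let : L.Structure M := e'.inducedStructure
  let E : C ≃[L] M := e'.inducedStructureEquiv
  have : Nonempty M := ⟨E (Classical.arbitrary C)⟩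
  have hM : M ⊨ universalTheory L B := ⟨fun φ hφ =>
    (h.trans (universalTheory_subset_of_embedding E.symm.toEmbedding) hφ).2⟩
  refine ⟨n, atomicTypeOf (E ∘ c), isCompleteAtomicType_atomicTypeOf hM _,
    hc.nonempty_equiv_factor _ fun t s => ?_⟩
  refine Iff.trans ?_ congruentClosure_positivePart_atomicTypeOf.symm
  rw [HomClass.realize_term, HomClass.realize_term, E.injective.eq_iff]

theorem universalTheory_subset_of_isDefinedByCompleteAtomicType
    (h : IsDefinedByCompleteAtomicType (universalTheory L B) C) :
    universalTheory L B ⊆ universalTheory L C := by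
  obtain ⟨n, p, hp, ⟨e⟩⟩ := h
  obtain ⟨M, _, _, a, hM, rfl⟩ := hp.exists_eq_atomicTypeOf
  obtain ⟨f, -⟩ := (generatedCongruence (positivePart
    (atomicTypeOf a : Set (L.Formula (Fin n))))).isGeneratingFamily.exists_embedding a fun t s =>
      (TermCongruence.realize_var_eq_iff _).trans congruentClosure_positivePart_atomicTypeOf
  refine subset_trans ?_ (universalTheory_subset_of_embedding (f.comp e.toEmbedding))
  exact fun φ hφ => ⟨hφ.1, hM.realize_of_mem φ hφ⟩

end AtomicTypes

/-! ### Discrimination and irreducible algebraic sets. -/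

section Irreducible

variable {L : FirstOrder.Language.{u, v}} [L.IsAlgebraic] {B : Type w} {C : Type w'}
  [L.Structure B] [L.Structure C]

/-- On each proper algebraic subset of `V_B(S)` some equation false at `c` holds. Given finitely
many such subsets, a homomorphism that separates the two sides of each of these equations is a point
of `V_B(S)` outside all of them. -/
theorem IsDiscriminatedBy.isIrreducibleCoordinateAlgebra (hC : Structure.FG L C)
    (h : IsDiscriminatedBy L C B) : IsIrreducibleCoordinateAlgebra L C B := by
  obtain ⟨n, c, hc⟩ := exists_isGeneratingFamily hC
  let S : Set (Equation L (Fin n)) := {e | e.1.realize c = e.2.realize c}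
  have hom_mem (g : C →[L] B) : g ∘ c ∈ solutionSet B S := fun e he => by
    rw [HomClass.realize_term, HomClass.realize_term, show e.1.realize c = e.2.realize c from he]
  refine ⟨n, solutionSet B S, ⟨⟨S, rfl⟩, ?_, ?_⟩, hc.nonempty_equiv_factor _ fun t s => ?_⟩
  · obtain ⟨g, -⟩ := h ∅ Set.finite_empty
    exact ⟨_, hom_mem g⟩
  · intro Z hZ hZY hcover
    have hex : ∀ W : Z, ∃ e : Equation L (Fin n), e.1.realize c ≠ e.2.realize c ∧
        ∀ b ∈ W.1, e.1.realize b = e.2.realize b := fun ⟨W, hW⟩ => by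
      obtain ⟨⟨S', rfl⟩, hne⟩ := hZY W hW
      obtain ⟨e, he, hec⟩ : ∃ e ∈ S', e ∉ S := by
        by_contra! hS
        exact hne.2 fun b hb e he => hb e (hS e he)
      exact ⟨e, hec, fun b hb => hb e he⟩
    choose ε hε hεW using hex
    have := hZ.to_subtype
    obtain ⟨g, hg⟩ := h
      (Set.range (fun W => (ε W).1.realize c) ∪ Set.range fun W => (ε W).2.realize c)
      ((Set.finite_range _).union (Set.finite_range _))
    obtain ⟨W, hW, hgW⟩ : g ∘ c ∈ ⋃₀ Z := hcover ▸ hom_mem g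
    have := hεW ⟨W, hW⟩ _ hgW
    rw [HomClass.realize_term, HomClass.realize_term] at this
    exact hε _ (hg (.inl ⟨_, rfl⟩) (.inr ⟨_, rfl⟩) this)
  -- Separating two elements at a time shows that the radical of `V_B(S)` is `S` itself.
  · refine ⟨fun hts b hb => hb (t, s) hts, fun hts => ?_⟩
    obtain ⟨g, hg⟩ := h {t.realize c, s.realize c} (Set.toFinite _)
    refine hg (by simp) (by simp) ?_
    have := hts _ (hom_mem g)
    rwa [HomClass.realize_term, HomClass.realize_term] at this

/-- A point of `Y` whose homomorphism identifies distinct `x`, `y` in `W` lies in the subset of `Y`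
cut out by `τ x = τ y`, which is proper since `x ≠ y` in the coordinate algebra. By irreducibility
these finitely many subsets do not cover `Y`. -/
theorem IsIrreducibleCoordinateAlgebra.isDiscriminatedBy
    (h : IsIrreducibleCoordinateAlgebra L C B) : IsDiscriminatedBy L C B := by
  obtain ⟨n, Y, ⟨⟨S, rfl⟩, -, hirr⟩, ⟨e⟩⟩ := h
  intro W hW
  let c (i : Fin n) : C :=
    e.symm ((radicalCongruence L (solutionSet B S)).toFactor (Term.var i))
  have hc : IsGeneratingFamily L c := fun x => by
    obtain ⟨t, ht⟩ := (radicalCongruence L (solutionSet B S)).isGeneratingFamily (e x)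
    refine ⟨t, ?_⟩
    have := HomClass.realize_term e.symm (t := t)
      (v := fun i => (radicalCongruence L (solutionSet B S)).toFactor (Term.var i))
    rw [ht, e.symm_apply_apply] at this
    exact this
  have hcr (t s : L.Term (Fin n)) : t.realize c = s.realize c ↔
      ∀ b ∈ solutionSet B S, t.realize b = s.realize b := by
    refine Iff.trans ?_ (TermCongruence.realize_var_eq_iff
      (radicalCongruence L (solutionSet B S)) (t := t) (s := s))
    refine Iff.trans ?_ e.symm.injective.eq_iff
    exact iff_of_eq (congrArg₂ _ (HomClass.realize_term e.symm) (HomClass.realize_term e.symm))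
  choose τ hτ using hc
  let Z : Set (Set (Fin n → B)) :=
    (fun p : C × C => solutionSet B (S ∪ {(τ p.1, τ p.2)})) '' W.offDiag
  have hZ : ∀ V ∈ Z, IsAlgebraicSet L V ∧ V ⊂ solutionSet B S := by
    rintro _ ⟨⟨x, y⟩, ⟨hx, hy, hxy⟩, rfl⟩
    refine ⟨⟨_, rfl⟩, fun b hb e he => hb e (.inl he), fun hsub => hxy ?_⟩
    rw [← hτ x, ← hτ y, hcr]
    exact fun b hb => hsub hb _ (.inr rfl)
  have hne := hirr Z (hW.offDiag.image _) hZ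
  obtain ⟨b, hb, hbZ⟩ : ∃ b ∈ solutionSet B S, b ∉ ⋃₀ Z := by
    by_contra! hsub
    exact hne ((Set.sUnion_subset fun V hV => (hZ V hV).2.subset).antisymm hsub)
  obtain ⟨f, hf⟩ := IsGeneratingFamily.exists_hom (fun x => ⟨τ x, hτ x⟩) b
    fun t s hts => (hcr t s).1 hts b hb
  refine ⟨f, fun x hx y hy hxy => ?_⟩
  by_contra hne
  refine hbZ ⟨_, ⟨(x, y), ⟨hx, hy, hne⟩, rfl⟩, ?_⟩
  rintro e (he | rfl)
  · exact hb e he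
  · rw [← hτ x, ← hτ y, hf, hf] at hxy
    exact hxy

end Irreducible

/-! ### Compactness and discrimination. -/

section Compactness

variable {L : FirstOrder.Language.{u, v}} {B : Type w} {C : Type w'}
  [L.Structure B] [L.Structure C]

/-- In a `u_ω`-compact algebra the inclusion of `V_B(S)` in a finite union of sets `V_B(e)` depends
on finitely many equations from `S`; the union may be empty if there are terms at all. -/
theorem IsUOmegaCompact.exists_finite_subset (hB : IsUOmegaCompact L B) {n : ℕ}
    (t₀ : L.Term (Fin n)) (S : Set (Equation L (Fin n))) {E : Set (Equation L (Fin n))}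
    (hE : E.Finite) (h : ∀ b ∈ solutionSet B S, ∃ e ∈ E, e.1.realize b = e.2.realize b) :
    ∃ S₀ ⊆ S, S₀.Finite ∧ ∀ b ∈ solutionSet B S₀, ∃ e ∈ E, e.1.realize b = e.2.realize b := by
  obtain rfl | hne := E.eq_empty_or_nonempty
  -- Compactness requires at least one equation on the right. For empty `E` a fresh variable `y` is
  -- added and `t₀ = y` is used.
  · let σ (e : Equation L (Fin n)) : Equation L (Fin (n + 1)) :=
      (e.1.relabel Fin.castSucc, e.2.relabel Fin.castSucc)
    have hσ (S : Set (Equation L (Fin n))) (b : Fin (n + 1) → B) :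
        b ∈ solutionSet B (σ '' S) ↔ b ∘ Fin.castSucc ∈ solutionSet B S := by
      refine Set.forall_mem_image.trans (forall₂_congr fun e _ => ?_)
      rw [Term.realize_relabel, Term.realize_relabel]
    obtain ⟨S₁, hS₁, hfin, -, hsub⟩ := hB (n + 1) (σ '' S) 1 le_rfl
      (fun _ => (t₀.relabel Fin.castSucc, Term.var (Fin.last n)))
      fun b hb => absurd (h _ ((hσ S b).1 hb)) (by simp)
    obtain ⟨S₀, hS₀, hfin₀, rfl⟩ := Set.exists_subset_image_finite_and.1 ⟨S₁, hS₁, hfin, rfl⟩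
    refine ⟨S₀, hS₀, hfin₀, fun b hb => ?_⟩
    -- The value of `y` is free, so a solution `b` of `S₀` forces `B` to have one element. Then `b`
    -- solves all of `S`, which has no solutions.
    have hall (y : B) : t₀.realize b = y := by
      have hy : Fin.snoc (α := fun _ => B) b y ∈ solutionSet B (σ '' S₀) := by
        rw [hσ]
        convert! hb
        funext i
        simp
      obtain ⟨-, hi⟩ := Set.mem_iUnion.1 (hsub hy)
      have := hi _ rfl
      simp only [Term.realize_relabel, Term.realize_var, Fin.snoc_last] at this
      rw [← this]
      congr 1
      funext i
      simp
    exact absurd (h b fun e _ => (hall _).symm.trans (hall _)) (by simp)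
  · have := hE.to_subtype
    obtain ⟨m, ⟨ε⟩⟩ := Finite.exists_equiv_fin E
    have hm : 1 ≤ m := by
      have := (ε ⟨_, hne.some_mem⟩).pos
      omega
    obtain ⟨S₀, hS₀, hfin, -, hsub⟩ := hB n S m hm (fun i => (ε.symm i).1) fun b hb => by
      obtain ⟨e, he, heb⟩ := h b hb
      refine Set.mem_iUnion.2 ⟨ε ⟨e, he⟩, ?_⟩
      rintro _ rfl
      simpa using heb
    refine ⟨S₀, hS₀, hfin, fun b hb => ?_⟩
    obtain ⟨i, hi⟩ := Set.mem_iUnion.1 (hsub hb)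
    exact ⟨_, (ε.symm i).2, hi _ rfl⟩

theorem isDiscriminatedBy_of_universalTheory_subset [L.IsAlgebraic] [Nonempty C]
    (hB : IsUOmegaCompact L B) (hC : Structure.FG L C)
    (h : universalTheory L B ⊆ universalTheory L C) : IsDiscriminatedBy L C B := by
  obtain ⟨n, c, hc⟩ := exists_isGeneratingFamily hC
  choose τ hτ using hc
  intro W hW
  let S : Set (Equation L (Fin n)) := {e | e.1.realize c = e.2.realize c}
  let E : Set (Equation L (Fin n)) := (fun p : C × C => (τ p.1, τ p.2)) '' W.offDiag
  have hEfin : E.Finite := hW.offDiag.image _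
  have hE : ∀ e ∈ E, e.1.realize c ≠ e.2.realize c := by
    rintro _ ⟨⟨x, y⟩, ⟨-, -, hxy⟩, rfl⟩
    simpa [hτ] using hxy
  -- Such a `b` is exactly a homomorphism injective on `W`. The set `E` is empty when `W` has at
  -- most one element.
  obtain ⟨b, hb, hbE⟩ : ∃ b ∈ solutionSet B S, ∀ e ∈ E, e.1.realize b ≠ e.2.realize b := by
    by_contra! hsub
    obtain ⟨S₀, hS₀, hfin, hsub'⟩ :=
      hB.exists_finite_subset (τ (Classical.arbitrary C)) S hEfin hsub
    obtain ⟨b, hb⟩ := exists_realize_of_universalTheory_subset h (c := c)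
      (D := (fun e => e.1.equal e.2) '' S₀ ∪ (fun e => (e.1.equal e.2).not) '' E)
      ((hfin.image _).union (hEfin.image _))
      (by
        rintro _ (⟨e, -, rfl⟩ | ⟨e, -, rfl⟩)
        · exact isQF_equal _ _
        · exact (isQF_equal _ _).not)
      (by
        rintro _ (⟨e, he, rfl⟩ | ⟨e, he, rfl⟩)
        · exact Formula.realize_equal.2 (hS₀ he)
        · exact fun hec => hE e he (Formula.realize_equal.1 hec))
    obtain ⟨e, he, heb⟩ := hsub' b fun e he =>
      Formula.realize_equal.1 (hb _ (.inl ⟨e, he, rfl⟩))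
    exact hb _ (.inr ⟨e, he, rfl⟩) (Formula.realize_equal.2 heb)
  obtain ⟨f, hf⟩ := IsGeneratingFamily.exists_hom (fun x => ⟨τ x, hτ x⟩) b
    fun t s hts => hb (t, s) hts
  refine ⟨f, fun x hx y hy hxy => ?_⟩
  by_contra hne
  rw [← hτ x, ← hτ y, hf, hf] at hxy
  exact hbE _ ⟨(x, y), ⟨hx, hy, hne⟩, rfl⟩ hxy

/-- If compactness fails, every finite `S₀ ⊆ S` has a solution `b S₀` at which no `e i` holds. Their
ultraproduct `a` satisfies all of `S` and no `e i`; a homomorphism to `B` from the algebra generated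
by `a`, injective on the sides of the `e i`, contradicts `hsub`. Algebras in `Type u` suffice, since
this one is a quotient of terms. -/
theorem isUOmegaCompact_of_forall_isDiscriminatedBy [L.IsAlgebraic]
    (h : ∀ (C : Type u) [L.Structure C] [Nonempty C], Structure.FG L C →
      EmbedsInUltrapower L C B → IsDiscriminatedBy L C B) : IsUOmegaCompact L B := by
  classical
  intro n S m hm e hsub
  by_contra! hfin
  have hfin' (S₀ : Finset S) : ∃ b : Fin n → B,
      (∀ e ∈ S₀, e.1.1.realize b = e.1.2.realize b) ∧
        ∀ i, (e i).1.realize b ≠ (e i).2.realize b := by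
    have := hfin (Subtype.val '' (S₀ : Set S)) (by simp) (S₀.finite_toSet.image _)
      fun b hb e he => hb e (by obtain ⟨e, -, rfl⟩ := he; exact e.2)
    obtain ⟨b, hb, hbe⟩ := Set.not_subset.1 this
    refine ⟨b, fun e he => hb _ ⟨e, he, rfl⟩, fun i hi => hbe (Set.mem_iUnion.2 ⟨i, ?_⟩)⟩
    rintro _ rfl
    exact hi
  choose b hbS hbe using hfin'
  obtain ⟨U, hU⟩ := exists_ultrafilter_eventually_ge (Finset S)
  let a (i : Fin n) : (U : Filter (Finset S)).Product fun _ => B := ((fun S₀ => b S₀ i : _ → B) :)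
  have ha (t s : L.Term (Fin n)) : t.realize a = s.realize a ↔
      ∀ᶠ S₀ in (U : Filter (Finset S)), t.realize (b S₀) = s.realize (b S₀) := by
    have key (t : L.Term (Fin n)) : t.realize a = _ :=
      Ultraproduct.term_realize_cast (fun i S₀ => b S₀ i) t
    rw [key, key]
    exact mk_product_eq_iff
  let θ : TermCongruence L (Fin n) := kernelCongruence a
  obtain ⟨f, -⟩ := θ.isGeneratingFamily.exists_embedding a fun t s => θ.realize_var_eq_iff
  -- Here `1 ≤ m` matters: without constants and with `n = 0` there would be no terms.
  have : Nonempty θ.Factor := ⟨θ.toFactor (e ⟨0, hm⟩).1⟩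
  obtain ⟨g, hg⟩ := h θ.Factor θ.isGeneratingFamily.fg ⟨Finset S, U, ⟨f⟩⟩
    (Set.range (fun i => θ.toFactor (e i).1) ∪ Set.range fun i => θ.toFactor (e i).2)
    ((Set.finite_range _).union (Set.finite_range _))
  have hgt (t : L.Term (Fin n)) :
      t.realize (fun x => g (θ.toFactor (Term.var x))) = g (θ.toFactor t) := by
    rw [← θ.realize_var t]
    exact HomClass.realize_term g
  have hgS : (fun x => g (θ.toFactor (Term.var x))) ∈ solutionSet B S := fun ε hε => by
    rw [hgt, hgt]
    refine congrArg g (θ.toFactor_eq_iff.2 ((ha _ _).2 ?_))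
    filter_upwards [hU {⟨ε, hε⟩}] with S₀ hS₀
    exact hbS S₀ _ (Finset.singleton_subset_iff.1 hS₀)
  obtain ⟨i, hi⟩ := Set.mem_iUnion.1 (hsub hgS)
  have hi' := hi _ rfl
  rw [hgt, hgt] at hi'
  -- By injectivity `e i` would hold at `a`, hence at `b S₀` for almost all `S₀`.
  have := θ.toFactor_eq_iff.1 (hg (.inl ⟨i, rfl⟩) (.inr ⟨i, rfl⟩) hi')
  obtain ⟨S₀, hS₀⟩ := ((ha _ _).1 this).exists
  exact hbe S₀ i hS₀

end Compactness

end UAG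

/-! ### The equivalence and its converse. -/

theorem theorem3p2 (L : FirstOrder.Language.{u, v}) [L.IsAlgebraic] (B : Type w) [L.Structure B] [Nonempty B] :
    (IsUOmegaCompact L B →
      ∀ (C : Type w') [L.Structure C] [Nonempty C], Structure.FG L C → List.TFAE [
        universalTheory L B ⊆ universalTheory L C,
        existentialTheory L C ⊆ existentialTheory L B,
        EmbedsInUltrapower L C B,
        IsDiscriminatedBy L C B,
        IsLimitAlgebraOver L C B,
        IsDefinedByCompleteAtomicType (universalTheory L B) C,
        IsIrreducibleCoordinateAlgebra L C B]) ∧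
    ((∀ (C : Type u) [L.Structure C] [Nonempty C], Structure.FG L C → List.TFAE [
        universalTheory L B ⊆ universalTheory L C,
        existentialTheory L C ⊆ existentialTheory L B,
        EmbedsInUltrapower L C B,
        IsDiscriminatedBy L C B,
        IsLimitAlgebraOver L C B,
        IsDefinedByCompleteAtomicType (universalTheory L B) C,
        IsIrreducibleCoordinateAlgebra L C B]) →
      IsUOmegaCompact L B) := by
  refine ⟨fun hB C _ _ hC => ?_, fun h => isUOmegaCompact_of_forall_isDiscriminatedBy
    -- Positions count from zero: this is 3 → 4, the only implication the converse needs.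
    fun C _ _ hC => ((h C hC).out 2 3).1⟩
  tfae_have 1 ↔ 2 := universalTheory_subset_iff
  tfae_have 1 → 5 := isLimitAlgebraOver_of_universalTheory_subset
  tfae_have 5 → 3 := IsLimitAlgebraOver.embedsInUltrapower
  tfae_have 3 → 1 := universalTheory_subset_of_embedsInUltrapower
  tfae_have 1 → 6 := isDefinedByCompleteAtomicType_of_universalTheory_subset hC
  tfae_have 6 → 1 := universalTheory_subset_of_isDefinedByCompleteAtomicType
  tfae_have 1 → 4 := isDiscriminatedBy_of_universalTheory_subset hB hC
  tfae_have 4 → 3 := IsDiscriminatedBy.embedsInUltrapower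
  tfae_have 4 → 7 := IsDiscriminatedBy.isIrreducibleCoordinateAlgebra hC
  tfae_have 7 → 4 := IsIrreducibleCoordinateAlgebra.isDiscriminatedBy
  tfae_finish
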